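/- Let $\mathbb V$ (variables) and $\mathbb F$ (factors) be finite sets, each factor $a\in\mathbb F$ having a set of variables $\{i\in\mathbb V: i\in a\}$, and let $q\in\mathbb N$. Let $\phi_i:\{1,\dots,q\}\to[0,\infty)$ for $i\in\mathbb V$ and $\psi_a:\{1,\dots,q\}^{a}\to(0,\infty)$ for $a\in\mathbb F$ be given functions. The factor graph $\mathcal G$ is the bipartite graph on $\mathbb F\cup\mathbb V$ with edge set $\mathbb E=\{ai: i\in a\}$; it is assumed to be connected, and $C$ denotes its number of independent cycles (the dimension of its cycle space). For a family of messages $m=(m_{a\to i}(k))_{ai\in\mathbb E,\,1\le k\le q}$ put $n_{i\to a}(k)=\phi_i(k)\prod_{a'\ni i,\,a'\ne a}m_{a'\to i}(k)$. The plain (unnormalized) belief propagation update is $m\mapsto\Theta(m)$ with $$\Theta_{ai,k}(m)=\sum_{x_a:\,x_i=k}\psi_a(x_a)\prod_{j\in a\setminus i}n_{j\to a}(x_j),$$ and the beliefs are $b_i(k)=\frac1{Z_i(m)}\phi_i(k)\prod_{a\ni i}m_{a\to i}(k)$ and $b_a(x_a)=\frac1{Z_a(m)}\psi_a(x_a)\prod_{i\in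 a}n_{i\to a}(x_i)$, where the constants $Z_i(m)$, $Z_a(m)$ normalize them to total mass $1$. A fixed point of plain BP is a family $m\ge 0$ with $\Theta(m)=m$ whose beliefs are defined, i.e. $Z_i(m)\neq0$ and $Z_a(m)\ne0$ for all $i$ and $a$. Let $A$ be the $0$-$1$ matrix indexed by $\mathbb E$ with $A_{ai}^{a'j}=1$ if and only if $j\in a\cap a'$, $j\ne i$ and $a'\neq a$. For a fixed point $m$, let $J=J(m)$ be the matrix indexed by $\mathbb E\times\{1,\dots,q\}$ with $$J_{ai,k}^{a'j,\ell}=b_a(x_j=\ell\mid x_i=k)\,A_{ai}^{a'j},\qquad b_a(x_j=\ell\mid x_i=k)=\frac{1}{b_i(k)}\sum_{x_a:\,x_i=k,\,x_j=\ell}b_a(x_a)$$ (entries in a row with $b_i(k)=0$ are read as $0$; irreducibility of $J$ excludes this case). **Theorem.** Suppose $C>1$. Let $m$ be a fixed point of plain BP whose matrix $J$ is irreducible. Then $A$ has a Perron eigenvalue $\lambda_1$ (an eigenvalue that equals the spectral radius of $A$ and has an eigenvector with positive coordinates), and $\lambda_1>1$. The spectral radius of $J$ and the spectral radius of the Jacobian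 matrix $\partial\Theta_{ai,k}/\partial m_{a'\to j}(\ell)$ of $\Theta$ at $m$ are both equal to $\lambda_1$. Consequently $m$ is not a stable fixed point of the iteration of $\Theta$: it is neither Lyapunov stable nor locally attractive, even if only initial families of strictly positive messages are allowed. -/

import Mathlib

open Filter Topology
open scoped ENNReal

noncomputable section

/-- A Markov random field on a finite factor graph. `V` indexes the variables, each with values in
`Fin q` (that is, `{1, …, q}`), `F` indexes the factors, and `scope a` is the set of variables of
the factor `a`. The associated measure is `p(x) = ∏ i, φ i (x i) * ∏ a, ψ a (x restricted to a)`;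
the factor functions `ψ a` never vanish. -/
structure FactorModel (V F : Type*) (q : ℕ) where
  scope : F → Finset V
  φ : V → Fin q → ℝ
  ψ : (a : F) → ({i // i ∈ scope a} → Fin q) → ℝ
  φ_nonneg : ∀ i k, 0 ≤ φ i k
  ψ_pos : ∀ a x, 0 < ψ a x

namespace FactorModel

variable {V F : Type*} [Fintype V] [Fintype F] [DecidableEq V] [DecidableEq F] {q : ℕ}
variable (M : FactorModel V F q)

/-- The factor graph: the bipartite graph on factors and variables in which `a` and `i` are
adjacent when `i ∈ a`. -/
def graph {V F : Type*} {q : ℕ} (M : FactorModel V F q) : SimpleGraph (F ⊕ V) :=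
  SimpleGraph.fromRel fun u v => ∃ a i, u = Sum.inl a ∧ v = Sum.inr i ∧ i ∈ M.scope a

/-- The edges `ai` of the factor graph: the pairs `(a, i)` with `i ∈ a`. -/
abbrev Edge {V F : Type*} {q : ℕ} (M : FactorModel V F q) : Type _ :=
  {e : F × V // e.2 ∈ M.scope e.1}

namespace Edge

variable {V F : Type*} {q : ℕ} {M : FactorModel V F q}

/-- The factor `a` of the edge `ai`. -/
abbrev fac (e : M.Edge) : F := e.1.1

/-- The variable `i` of the edge `ai`. -/
abbrev var (e : M.Edge) : V := e.1.2

/-- The variable `i` of the edge `ai`, as an element of the scope of `a`. -/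
abbrev loc (e : M.Edge) : {i // i ∈ M.scope e.fac} := ⟨e.var, e.2⟩

end Edge

/-- The boundary operator of the factor graph, every edge `ai` being oriented from `i` to `a`. -/
def boundary : (M.Edge → ℚ) →ₗ[ℚ] (F ⊕ V → ℚ) where
  toFun w := Sum.elim
    (fun a => ∑ e : M.Edge, if e.fac = a then w e else 0)
    (fun i => -∑ e : M.Edge, if e.var = i then w e else 0)
  map_add' w w' := by
    ext (a | i) <;> simp [Finset.sum_add_distrib, ← Finset.sum_filter, add_comm]
  map_smul' c w := by
    ext (a | i) <;> simp [Finset.mul_sum, ← Finset.sum_filter]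

/-- The number `C` of independent cycles of the factor graph: the dimension of its cycle space
(the kernel of the boundary operator). -/
def numCycles : ℕ := Module.finrank ℚ (LinearMap.ker M.boundary)

/-- Families of messages: `m (ai, k)` is the message `m_{a → i}(k)`. -/
abbrev Messages {V F : Type*} {q : ℕ} (M : FactorModel V F q) : Type _ := M.Edge × Fin q → ℝ

/-- The message from a variable to a factor,
`n_{i → a}(k) = φ_i(k) ∏_{a' ∋ i, a' ≠ a} m_{a' → i}(k)`. -/
def varMsg (m : M.Messages) (i : V) (a : F) (k : Fin q) : ℝ :=
  M.φ i k * ∏ e : M.Edge with e.var = i ∧ e.fac ≠ a, m (e, k)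

/-- The plain (unnormalized) belief propagation map,
`Θ_{ai,k}(m) = ∑_{x_a : x_i = k} ψ_a(x_a) ∏_{j ∈ a, j ≠ i} n_{j → a}(x_j)`. -/
def bp (m : M.Messages) : M.Messages := fun p =>
  ∑ x : {i // i ∈ M.scope p.1.fac} → Fin q with x p.1.loc = p.2,
    M.ψ p.1.fac x * ∏ j : {j // j ∈ M.scope p.1.fac} with j ≠ p.1.loc, M.varMsg m j p.1.fac (x j)

/-- The unnormalized belief of a variable. -/
def varWeight (m : M.Messages) (i : V) (k : Fin q) : ℝ :=
  M.φ i k * ∏ e : M.Edge with e.var = i, m (e, k)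

/-- The unnormalized belief of a factor. -/
def facWeight (m : M.Messages) (a : F) (x : {i // i ∈ M.scope a} → Fin q) : ℝ :=
  M.ψ a x * ∏ i : {i // i ∈ M.scope a}, M.varMsg m i a (x i)

/-- The normalization constant `Z_i(m)`. -/
def varZ (m : M.Messages) (i : V) : ℝ := ∑ k, M.varWeight m i k

/-- The normalization constant `Z_a(m)`. -/
def facZ (m : M.Messages) (a : F) : ℝ := ∑ x, M.facWeight m a x

/-- The belief `b_i`. -/
def varBelief (m : M.Messages) (i : V) (k : Fin q) : ℝ := M.varWeight m i k / M.varZ m i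

/-- The belief `b_a`. -/
def facBelief (m : M.Messages) (a : F) (x : {i // i ∈ M.scope a} → Fin q) : ℝ :=
  M.facWeight m a x / M.facZ m a

/-- The conditional belief `b_a(x_j = l | x_i = k) = ∑_{x_a : x_i = k, x_j = l} b_a(x_a) / b_i(k)`,
for `i, j ∈ a`. -/
def condBelief (m : M.Messages) (a : F) (i j : {i // i ∈ M.scope a}) (k l : Fin q) : ℝ :=
  ∑ x : {i // i ∈ M.scope a} → Fin q with x i = k ∧ x j = l,
    M.facBelief m a x / M.varBelief m i k

/-- `m` is a fixed point of plain belief propagation: a family of nonnegative messages, invariant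
under the plain update, whose beliefs are defined (no normalization constant vanishes). -/
structure IsFixedPoint (m : M.Messages) : Prop where
  nonneg : ∀ p, 0 ≤ m p
  fixed : M.bp m = m
  varZ_ne_zero : ∀ i, M.varZ m i ≠ 0
  facZ_ne_zero : ∀ a, M.facZ m a ≠ 0

/-- The links `ai → a'j` of the oriented line graph: `j ∈ a ∩ a'`, `j ≠ i` and `a' ≠ a`. -/
def Link {V F : Type*} {q : ℕ} (M : FactorModel V F q) (e f : M.Edge) : Prop :=
  f.var ∈ M.scope e.fac ∧ f.var ≠ e.var ∧ f.fac ≠ e.fac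

open Classical in
/-- The adjacency matrix `A` of the oriented line graph. -/
def A {V F : Type*} {q : ℕ} (M : FactorModel V F q) : Matrix M.Edge M.Edge ℝ :=
  Matrix.of fun e f => if M.Link e f then 1 else 0

open Classical in
/-- The belief Jacobian `J`: its entry at `(ai, k)`, `(a'j, l)` is
`b_a(x_j = l | x_i = k)` if `ai → a'j` is a link, and `0` otherwise. -/
def J (m : M.Messages) : Matrix (M.Edge × Fin q) (M.Edge × Fin q) ℝ :=
  Matrix.of fun p r =>
    if h : M.Link p.1 r.1 then
      M.condBelief m p.1.fac p.1.loc ⟨r.1.var, h.1⟩ p.2 r.2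
    else 0

/-- The Jacobian matrix of the plain belief propagation map, with entries
`∂Θ_{ai,k} / ∂m_{a' → j}(l)`. -/
def bpJacobian (m : M.Messages) : Matrix (M.Edge × Fin q) (M.Edge × Fin q) ℝ :=
  LinearMap.toMatrix' (fderiv ℝ M.bp m).toLinearMap

/-- The families of strictly positive messages. -/
def posMessages {V F : Type*} {q : ℕ} (M : FactorModel V F q) : Set M.Messages :=
  {m | ∀ p, 0 < m p}

end FactorModel

/-- The spectral radius of a real square matrix: the largest modulus of its complex eigenvalues. -/
def matrixSpectralRadius {n : Type*} [Fintype n] [DecidableEq n] (B : Matrix n n ℝ) : ℝ≥0∞ :=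
  spectralRadius ℂ (B.map (fun t : ℝ => (t : ℂ)))

/-- `r` is the Perron eigenvalue of the matrix `B`: it is the spectral radius of `B`, and it is
an eigenvalue that has an eigenvector with positive coordinates. -/
def IsPerronEigenvalue {n : Type*} [Fintype n] [DecidableEq n] (B : Matrix n n ℝ) (r : ℝ) : Prop :=
  0 ≤ r ∧ matrixSpectralRadius B = ENNReal.ofReal r ∧
    ∃ v : n → ℝ, (∀ i, 0 < v i) ∧ B.mulVec v = r • v

/-- The point `x` is stable (in the sense of Lyapunov) under the iteration of `f` started in `S`:
orbits that start close enough to `x` in `S` stay arbitrarily close to `x`. -/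
def IsLyapunovStable {X : Type*} [TopologicalSpace X] (f : X → X) (S : Set X) (x : X) : Prop :=
  ∀ U ∈ 𝓝 x, ∀ᶠ y in 𝓝[S] x, ∀ n : ℕ, f^[n] y ∈ U

/-- The point `x` is locally attractive under the iteration of `f` started in `S`: orbits that start
close enough to `x` in `S` converge to `x`. -/
def IsLocallyAttractive {X : Type*} [TopologicalSpace X] (f : X → X) (S : Set X) (x : X) : Prop :=
  ∀ᶠ y in 𝓝[S] x, Tendsto (fun n : ℕ => f^[n] y) atTop (𝓝 x)

end

/-! Multiplying the messages along each edge `e` by `exp (u e)`, the same factor for all states,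
turns `Θ(m)` into `exp (A u) Θ(m)` (`bp_exp_mul`): plain BP acts linearly, through `A`, on the
logarithms of such factors. If `m` is a fixed point and `A v = r v` with `v > 0`, the orbit of `exp
(ε v) m` is therefore exactly `exp (ε r ^ n v) m`. For `r > 1` and `m > 0` it diverges for every `ε
> 0`, which excludes both kinds of stability.

The same `v` gives the spectral radii, since a nonnegative matrix with a positive eigenvector has
the corresponding eigenvalue as its spectral radius. Differentiating the scaling identity shows that
`v m` is an eigenvector of the Jacobian; conditional beliefs sum to `1`, so `v`, taken constant in
the states, is an eigenvector of `J`.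

For `r > 1`: irreducibility of `J` passes to `A`, so `v` exists by Perron–Frobenius and all row sums
of `A` are at least `1`. If `r ≤ 1`, they all equal `1`, every edge has a unique successor, and a
cycle is determined by its value on one edge. Hence `C ≤ 1`. -/

namespace Matrix

/-! ### Propagation along the positive entries of an irreducible matrix. -/

section Irreducible

variable {n : Type*} {B : Matrix n n ℝ}

/-- A property that is inherited along the positive entries of an irreducible matrix holds
everywhere as soon as it holds somewhere. -/
theorem IsIrreducible.forall_of_step (hB : B.IsIrreducible) {P : n → Prop} {i : n} (hi : P i)
    (h : ∀ i j, 0 < B i j → P i → P j) (j : n) : P j := by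
  let := toQuiver B
  obtain ⟨p, -⟩ := hB.connected i j
  induction p with
  | nil => exact hi
  | cons _ e ih => exact h _ _ e.down ih

theorem IsIrreducible.exists_col_pos (hB : B.IsIrreducible) (j : n) : ∃ i, 0 < B i j := by
  let := toQuiver B
  obtain ⟨p, hp⟩ := hB.connected j j
  cases p with
  | nil => simp at hp
  | cons _ e => exact ⟨_, e.down⟩

theorem IsIrreducible.exists_row_pos (hB : B.IsIrreducible) (i : n) : ∃ j, 0 < B i j :=
  hB.transpose.exists_col_pos i

/-- The image of an irreducible matrix under a surjection that respects positive entries is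
irreducible. -/
theorem IsIrreducible.of_surjective {n' : Type*} {B' : Matrix n' n' ℝ} (hB : B.IsIrreducible)
    (hB' : ∀ i j, 0 ≤ B' i j) {f : n → n'} (hf : f.Surjective)
    (h : ∀ i j, 0 < B i j → 0 < B' (f i) (f j)) : B'.IsIrreducible := by
  refine ⟨hB', ?_⟩
  let := toQuiver B
  let := toQuiver B'
  intro i' j'
  obtain ⟨i, rfl⟩ := hf i'
  obtain ⟨j, rfl⟩ := hf j'
  obtain ⟨p, hp⟩ := hB.connected i j
  have key : ∀ {j : n} (p : Quiver.Path i j),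
      ∃ p' : Quiver.Path (f i) (f j), p'.length = p.length := by
    intro j p
    induction p with
    | nil => exact ⟨Quiver.Path.nil, rfl⟩
    | cons _ e ih =>
      obtain ⟨p', hp'⟩ := ih
      exact ⟨p'.cons (PLift.up (h _ _ e.down)), by simp [hp']⟩
  obtain ⟨p', hp'⟩ := key p
  exact ⟨p', hp' ▸ hp⟩

end Irreducible

/-! ### Perron–Frobenius theory. -/

section PerronFrobenius

variable {n : Type*} [Fintype n] {B : Matrix n n ℝ}

theorem mulVec_pos_of_pos {P : Matrix n n ℝ} (hP : ∀ i j, 0 < P i j) {z : n → ℝ}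
    (hz : ∀ i, 0 ≤ z i) (hz0 : z ≠ 0) (i : n) : 0 < (P *ᵥ z) i := by
  obtain ⟨j, hj⟩ := Function.ne_iff.1 hz0
  exact Finset.sum_pos' (fun k _ => mul_nonneg (hP i k).le (hz k))
    ⟨j, Finset.mem_univ j, mul_pos (hP i j) (lt_of_le_of_ne (hz j) (Ne.symm hj))⟩

/-- If all row sums of an irreducible matrix are at least `1` and it has a positive eigenvector with
eigenvalue at most `1`, then all row sums are equal to `1`. -/
theorem IsIrreducible.sum_row_eq_one [Nonempty n] (hB : B.IsIrreducible)
    (hsum : ∀ i, 1 ≤ ∑ j, B i j) {r : ℝ} (hr : r ≤ 1) {v : n → ℝ} (hv : ∀ i, 0 < v i)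
    (h : B *ᵥ v = r • v) (i : n) : ∑ j, B i j = 1 := by
  obtain ⟨i₀, hi₀⟩ := Finite.exists_min v
  have hrow : ∀ i, ∑ j, B i j * v j = r * v i := fun i => congrFun h i
  -- At a minimum of `v`, `r * v i₀` is at least the row sum times `v i₀`, hence at least `v i₀ ≥ r
  -- * v i₀`. Equality throughout makes every neighbour a minimum too.
  have hmin : ∀ i, v i = v i₀ →
      (∑ j, B i j * (v j - v i₀) = 0) ∧ ∑ j, B i j = 1 := by
    intro i hi
    have h1 : ∑ j, B i j * (v j - v i₀) = r * v i₀ - (∑ j, B i j) * v i₀ := by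
      simp only [mul_sub, Finset.sum_sub_distrib, ← Finset.sum_mul, hrow, hi]
    have h2 : 0 ≤ ∑ j, B i j * (v j - v i₀) :=
      Finset.sum_nonneg fun j _ => mul_nonneg (hB.nonneg i j) (sub_nonneg.2 (hi₀ j))
    have h3 : r * v i₀ ≤ v i₀ := mul_le_of_le_one_left (hv i₀).le hr
    have h4 : v i₀ ≤ (∑ j, B i j) * v i₀ := le_mul_of_one_le_left (hv i₀).le (hsum i)
    refine ⟨by linarith, ?_⟩
    have h5 : (∑ j, B i j) * v i₀ = 1 * v i₀ := by linarith
    exact mul_right_cancel₀ (hv i₀).ne' h5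
  refine (hmin i (hB.forall_of_step (P := fun i => v i = v i₀) rfl (fun i j hij hi => ?_) i)).2
  have h0 := (Finset.sum_eq_zero_iff_of_nonneg fun j _ =>
    mul_nonneg (hB.nonneg i j) (sub_nonneg.2 (hi₀ j))).1 (hmin i hi).1 j (Finset.mem_univ j)
  rcases mul_eq_zero.1 h0 with h0 | h0
  · exact absurd h0 hij.ne'
  · exact sub_eq_zero.1 h0

variable [DecidableEq n]

/-- For an irreducible matrix there is a positive matrix commuting with it. -/
theorem IsIrreducible.exists_pos_commute (hB : B.IsIrreducible) :
    ∃ P : Matrix n n ℝ, (∀ i j, 0 < P i j) ∧ Commute P B := by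
  choose k _ hk using (isIrreducible_iff_exists_pow_pos hB.nonneg).1 hB
  refine ⟨∑ p : n × n, B ^ k p.1 p.2, fun i j => ?_, ?_⟩
  · rw [Matrix.sum_apply]
    exact Finset.sum_pos' (fun p _ => pow_apply_nonneg hB.nonneg _ i j)
      ⟨(i, j), Finset.mem_univ _, hk i j⟩
  · exact Commute.sum_left _ _ _ fun p _ => (Commute.refl B).pow_left _

/-- **Perron–Frobenius**: an irreducible matrix has a positive eigenvector. -/
theorem IsIrreducible.exists_pos_eigenvector [Nonempty n] (hB : B.IsIrreducible) :
    ∃ r : ℝ, 0 ≤ r ∧ ∃ v : n → ℝ, (∀ i, 0 < v i) ∧ B *ᵥ v = r • v := by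
  obtain ⟨P, hP, hPB⟩ := hB.exists_pos_commute
  -- Collatz–Wielandt: maximize `r` subject to `r x ≤ B x` on the simplex. The sum of all entries
  -- bounds `r`, so `K` is compact.
  set K : Set (ℝ × (n → ℝ)) := (Set.Icc 0 (∑ i, ∑ j, B i j) ×ˢ stdSimplex ℝ n) ∩
    {p | ∀ i, p.1 * p.2 i ≤ (B *ᵥ p.2) i} with hK
  have hbound : ∀ (r : ℝ) (x : n → ℝ), x ∈ stdSimplex ℝ n → (∀ i, r * x i ≤ (B *ᵥ x) i) →
      r ≤ ∑ i, ∑ j, B i j := by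
    intro r x hx h
    calc r = ∑ i, r * x i := by rw [← Finset.mul_sum, hx.2, mul_one]
      _ ≤ ∑ i, (B *ᵥ x) i := Finset.sum_le_sum fun i _ => h i
      _ ≤ ∑ i, ∑ j, B i j := Finset.sum_le_sum fun i _ => Finset.sum_le_sum fun j _ =>
        mul_le_of_le_one_right (hB.nonneg i j)
          (hx.2 ▸ Finset.single_le_sum (fun k _ => hx.1 k) (Finset.mem_univ j))
  have hcpt : IsCompact K := by
    refine (isCompact_Icc.prod (isCompact_stdSimplex ℝ n)).inter_right ?_
    simp only [Set.ofPred_forall]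
    refine isClosed_iInter fun i => isClosed_le (by fun_prop) ?_
    simp only [mulVec, dotProduct]
    fun_prop
  have hne : K.Nonempty := by
    obtain ⟨i⟩ := ‹Nonempty n›
    refine ⟨(0, Pi.single i 1), ⟨⟨le_rfl, ?_⟩, single_mem_stdSimplex ℝ i⟩, fun j => ?_⟩
    · exact Finset.sum_nonneg fun i _ => Finset.sum_nonneg fun j _ => hB.nonneg i j
    · simpa using hB.nonneg j i
  obtain ⟨⟨r, x⟩, ⟨⟨hr, hx⟩, hrx⟩, hmax⟩ := hcpt.exists_isMaxOn hne continuous_fst.continuousOn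
  simp only at hr hx
  have hx0 : x ≠ 0 := by
    rintro rfl
    simpa using hx.2
  have hy : ∀ i, 0 < (P *ᵥ x) i := mulVec_pos_of_pos hP hx.1 hx0
  have hcomm : B *ᵥ (P *ᵥ x) - r • (P *ᵥ x) = P *ᵥ (B *ᵥ x - r • x) := by
    rw [mulVec_sub, mulVec_smul, mulVec_mulVec, mulVec_mulVec, hPB.eq]
  -- Otherwise `P` makes this nonnegative defect strictly positive, and the normalized `P *ᵥ x`
  -- admits `r + δ`, with `δ` the least ratio of the new defect to `P *ᵥ x`. This contradicts
  -- maximality.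
  have heig : B *ᵥ x - r • x = 0 := by
    by_contra hne0
    have hz : ∀ i, 0 < (P *ᵥ (B *ᵥ x - r • x)) i :=
      mulVec_pos_of_pos hP (fun i => by simpa using hrx i) hne0
    obtain ⟨i₀, hi₀⟩ := Finite.exists_min fun i => (P *ᵥ (B *ᵥ x - r • x)) i / (P *ᵥ x) i
    set δ := (P *ᵥ (B *ᵥ x - r • x)) i₀ / (P *ᵥ x) i₀ with hδ
    have hδpos : 0 < δ := div_pos (hz i₀) (hy i₀)
    set s := ∑ i, (P *ᵥ x) i with hs
    have hspos : 0 < s := Finset.sum_pos (fun i _ => hy i) Finset.univ_nonempty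
    have hmem : s⁻¹ • (P *ᵥ x) ∈ stdSimplex ℝ n := by
      refine ⟨fun i => mul_nonneg (inv_nonneg.2 hspos.le) (hy i).le, ?_⟩
      simp only [Pi.smul_apply, smul_eq_mul, ← Finset.mul_sum]
      exact inv_mul_cancel₀ hspos.ne'
    have hle : ∀ i, (r + δ) * (s⁻¹ • (P *ᵥ x)) i ≤ (B *ᵥ (s⁻¹ • (P *ᵥ x))) i := by
      intro i
      have h1 := (le_div_iff₀ (hy i)).1 (hi₀ i)
      have h2 := congrFun hcomm i
      simp only [Pi.sub_apply, Pi.smul_apply, smul_eq_mul] at h2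
      rw [mulVec_smul]
      simp only [Pi.smul_apply, smul_eq_mul]
      rw [mul_left_comm]
      refine mul_le_mul_of_nonneg_left ?_ (inv_nonneg.2 hspos.le)
      linarith
    have := hmax (a := (r + δ, s⁻¹ • (P *ᵥ x)))
      ⟨⟨⟨by linarith [hr.1], hbound _ _ hmem hle⟩, hmem⟩, hle⟩
    simp only [Set.mem_ofPred_eq] at this
    linarith
  refine ⟨r, hr.1, P *ᵥ x, hy, sub_eq_zero.1 ?_⟩
  rw [hcomm, heig, mulVec_zero]

/-- The spectral radius of a nonnegative matrix with a positive eigenvector is the corresponding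
eigenvalue. -/
theorem spectralRadius_eq_of_pos_eigenvector [Nonempty n] (hB : ∀ i j, 0 ≤ B i j) {r : ℝ}
    {v : n → ℝ} (hv : ∀ i, 0 < v i) (h : B *ᵥ v = r • v) :
    matrixSpectralRadius B = ENNReal.ofReal r := by
  have hrow : ∀ i, ∑ j, B i j * v j = r * v i := fun i => congrFun h i
  have hr : 0 ≤ r := by
    obtain ⟨i⟩ := ‹Nonempty n›
    have : 0 ≤ r * v i := hrow i ▸ Finset.sum_nonneg fun j _ => mul_nonneg (hB i j) (hv j).le
    exact nonneg_of_mul_nonneg_left this (hv i)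
  have hspec : ∀ μ : ℂ, μ ∈ spectrum ℂ (B.map fun t : ℝ => (t : ℂ)) ↔
      ∃ w : n → ℂ, w ≠ 0 ∧ ∀ i, ∑ j, (B i j : ℂ) * w j = μ * w i := by
    intro μ
    rw [← Matrix.spectrum_toLin', ← Module.End.hasEigenvalue_iff_mem_spectrum]
    constructor
    · intro hμ
      obtain ⟨w, hw⟩ := hμ.exists_hasEigenvector
      exact ⟨w, hw.2, fun i => congrFun hw.apply_eq_smul i⟩
    · rintro ⟨w, hw0, hw⟩
      refine Module.End.hasEigenvalue_of_hasEigenvector (x := w) ⟨?_, hw0⟩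
      rw [Module.End.mem_eigenspace_iff]
      exact funext hw
  refine le_antisymm (iSup₂_le fun μ hμ => ?_) ?_
  · obtain ⟨w, hw0, hw⟩ := (hspec μ).1 hμ
    -- With `c` the largest ratio, `‖w‖ ≤ c v` with equality at `i`; row `i` of the eigenvalue
    -- equation then gives `‖μ‖ ≤ r`.
    obtain ⟨i, hi⟩ := Finite.exists_max fun i => ‖w i‖ / v i
    set c := ‖w i‖ / v i with hc
    have hle : ∀ j, ‖w j‖ ≤ c * v j := fun j => (div_le_iff₀ (hv j)).1 (hi j)
    have hcv : c * v i = ‖w i‖ := div_mul_cancel₀ _ (hv i).ne'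
    have hcpos : 0 < ‖w i‖ := by
      obtain ⟨j, hj⟩ := Function.ne_iff.1 hw0
      have h1 : 0 < c * v j := (norm_pos_iff.2 hj).trans_le (hle j)
      exact hcv ▸ mul_pos (pos_of_mul_pos_left h1 (hv j).le) (hv i)
    have key : ‖μ‖ * ‖w i‖ ≤ r * ‖w i‖ := by
      calc ‖μ‖ * ‖w i‖ = ‖∑ j, (B i j : ℂ) * w j‖ := by rw [hw, norm_mul]
        _ ≤ ∑ j, B i j * (c * v j) := by
          refine (norm_sum_le _ _).trans (Finset.sum_le_sum fun j _ => ?_)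
          rw [norm_mul, Complex.norm_real, Real.norm_of_nonneg (hB i j)]
          exact mul_le_mul_of_nonneg_left (hle j) (hB i j)
        _ = c * ∑ j, B i j * v j := by
          rw [Finset.mul_sum]
          exact Finset.sum_congr rfl fun j _ => by ring
        _ = r * ‖w i‖ := by rw [hrow, ← hcv]; ring
    have hμr : ‖μ‖ ≤ r := le_of_mul_le_mul_right key hcpos
    rw [← enorm_eq_nnnorm, ← ofReal_norm]
    exact ENNReal.ofReal_le_ofReal hμr
  · have hmem : (r : ℂ) ∈ spectrum ℂ (B.map fun t : ℝ => (t : ℂ)) := by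
      refine (hspec _).2 ⟨fun i => (v i : ℂ), fun h0 => ?_, fun i => ?_⟩
      · obtain ⟨i⟩ := ‹Nonempty n›
        have := congrFun h0 i
        simp [(hv i).ne'] at this
      · beta_reduce
        exact_mod_cast hrow i
    refine le_trans ?_ (le_iSup₂_of_le (r : ℂ) hmem le_rfl)
    rw [← enorm_eq_nnnorm, ← ofReal_norm, Complex.norm_real, Real.norm_of_nonneg hr]

end PerronFrobenius

end Matrix

namespace FactorModel

/-! ### The oriented line graph and the cycle space. -/

section Combinatorics

variable {V F : Type*} [Fintype V] [Fintype F] [DecidableEq V] [DecidableEq F] {q : ℕ}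
variable {M : FactorModel V F q}

omit [Fintype V] [Fintype F] [DecidableEq V] [DecidableEq F] in
theorem Edge.ext_of_fac_var {e f : M.Edge} (hfac : e.fac = f.fac) (hvar : e.var = f.var) : e = f :=
  Subtype.ext (Prod.ext hfac hvar)

omit [Fintype V] [Fintype F] [DecidableEq V] [DecidableEq F] in
theorem A_nonneg (e f : M.Edge) : 0 ≤ M.A e f := by
  simp only [A, Matrix.of_apply]
  split_ifs <;> norm_num

omit [Fintype V] [Fintype F] [DecidableEq V] [DecidableEq F] in
theorem A_of_link {e f : M.Edge} (h : M.Link e f) : M.A e f = 1 := by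
  simp [A, h]

omit [Fintype V] [Fintype F] [DecidableEq V] [DecidableEq F] in
theorem A_of_not_link {e f : M.Edge} (h : ¬ M.Link e f) : M.A e f = 0 := by
  simp [A, h]

omit [Fintype V] [Fintype F] [DecidableEq V] [DecidableEq F] in
theorem link_of_A_pos {e f : M.Edge} (h : 0 < M.A e f) : M.Link e f := by
  by_contra hn
  exact h.ne' (A_of_not_link hn)

omit [DecidableEq F] in
theorem one_le_sum_A (hA : M.A.IsIrreducible) (e : M.Edge) : 1 ≤ ∑ f, M.A e f := by
  obtain ⟨f, hf⟩ := hA.exists_row_pos e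
  rw [← A_of_link (link_of_A_pos hf)]
  exact Finset.single_le_sum (fun g _ => A_nonneg e g) (Finset.mem_univ f)

theorem link_unique_of_sum_A {e f g : M.Edge} (h : ∑ f, M.A e f = 1) (hf : M.Link e f)
    (hg : M.Link e g) : f = g := by
  by_contra hne
  have := Finset.sum_le_sum_of_subset_of_nonneg (Finset.subset_univ ({f, g} : Finset M.Edge))
    (fun x _ _ => A_nonneg e x)
  rw [Finset.sum_pair hne, A_of_link hf, A_of_link hg, h] at this
  norm_num at this

/-- If every edge has exactly one successor in the strongly connected oriented line graph, then a
cycle that vanishes on an edge vanishes on its successors. -/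
theorem cycle_eq_zero_of_link (hA : M.A.IsIrreducible)
    (huniq : ∀ e f g : M.Edge, M.Link e f → M.Link e g → f = g) {w : M.Edge → ℚ}
    (hw : M.boundary w = 0) {e f : M.Edge} (hef : M.Link e f) (he : w e = 0) : w f = 0 := by
  -- The path `e, g, f` has inner nodes `e.fac` and `f.var`. Both turn out to have degree two, so
  -- the boundary equations there give `w e = -w g = w f`.
  set g : M.Edge := ⟨(e.fac, f.var), hef.1⟩ with hg
  have hge : e ≠ g := fun h => hef.2.1 (congrArg Edge.var h).symm
  have hgf : g ≠ f := fun h => hef.2.2 (congrArg Edge.fac h).symm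
  have hfac : ∀ h : M.Edge, h ≠ e ∧ h ≠ g → h.fac ≠ e.fac := by
    rintro h ⟨hne, hng⟩ hh
    have hvar : h.var ≠ e.var := fun h' => hne (Edge.ext_of_fac_var hh h')
    have hvar' : h.var ≠ f.var := fun h' => hng (Edge.ext_of_fac_var hh h')
    -- A predecessor of a third edge `h` at `e.fac` supplies another factor containing `h.var`,
    -- hence a second successor of `e`.
    obtain ⟨h', hh'⟩ := hA.exists_col_pos h
    have hl := link_of_A_pos hh'
    have := huniq e f ⟨(h'.fac, h.var), hl.1⟩ hef
      ⟨hh ▸ h.2, hvar, fun hc => hl.2.2 (hh.trans hc.symm)⟩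
    exact hvar' (congrArg Edge.var this).symm
  have hvar : ∀ h : M.Edge, h ≠ g ∧ h ≠ f → h.var ≠ f.var := by
    rintro h ⟨hng, hnf⟩ hh
    have hne : h.fac ≠ e.fac := fun h' => hng (Edge.ext_of_fac_var h' hh)
    exact hnf (huniq e h f ⟨hh ▸ hef.1, hh ▸ hef.2.1, hne⟩ hef)
  have h1 : w e + w g = 0 := by
    have := congrFun hw (Sum.inl e.fac)
    simp only [boundary, LinearMap.coe_mk, AddHom.coe_mk, Sum.elim_inl, Pi.zero_apply] at this
    rw [Fintype.sum_eq_add e g hge fun h hh => if_neg (hfac h hh)] at this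
    simpa [hg] using this
  have h2 : w g + w f = 0 := by
    have := congrFun hw (Sum.inr f.var)
    simp only [boundary, LinearMap.coe_mk, AddHom.coe_mk, Sum.elim_inr, Pi.zero_apply,
      neg_eq_zero] at this
    rw [Fintype.sum_eq_add g f hgf fun h hh => if_neg (hvar h hh)] at this
    simpa [hg] using this
  linarith

/-- Evaluation at a single edge is injective on the cycle space, because vanishing spreads along
links. -/
theorem numCycles_le_one (hA : M.A.IsIrreducible)
    (huniq : ∀ e f g : M.Edge, M.Link e f → M.Link e g → f = g) : M.numCycles ≤ 1 := by
  rcases isEmpty_or_nonempty M.Edge with hE | ⟨⟨e⟩⟩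
  · have : Subsingleton (LinearMap.ker M.boundary) := inferInstance
    simp [numCycles, Module.finrank_zero_of_subsingleton]
  · set ev : LinearMap.ker M.boundary →ₗ[ℚ] ℚ :=
      LinearMap.proj e ∘ₗ (LinearMap.ker M.boundary).subtype with hev
    have hinj : Function.Injective ev := by
      rw [injective_iff_map_eq_zero]
      rintro ⟨w, hw⟩ hwe
      have hwe' : w e = 0 := hwe
      refine Subtype.ext (funext fun f => ?_)
      exact hA.forall_of_step (P := fun f => w f = 0) hwe' (fun f g hfg hf =>
        cycle_eq_zero_of_link hA huniq hw (link_of_A_pos hfg) hf) f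
    simpa [numCycles] using LinearMap.finrank_le_finrank_of_injective hinj

theorem nonempty_edge_of_numCycles (hC : 1 < M.numCycles) : Nonempty M.Edge := by
  by_contra hE
  rw [not_nonempty_iff] at hE
  have : Subsingleton (LinearMap.ker M.boundary) := inferInstance
  simp [numCycles, Module.finrank_zero_of_subsingleton] at hC

/-- If there is more than one independent cycle and the oriented line graph is strongly connected,
then an eigenvalue of `A` with a positive eigenvector is greater than `1`. -/
theorem one_lt_of_pos_eigenvector (hC : 1 < M.numCycles) (hA : M.A.IsIrreducible) {r : ℝ}
    {v : M.Edge → ℝ} (hv : ∀ e, 0 < v e) (h : M.A.mulVec v = r • v) : 1 < r := by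
  have := nonempty_edge_of_numCycles hC
  by_contra! hr
  refine hC.not_ge (numCycles_le_one hA fun e f g hf hg => ?_)
  exact link_unique_of_sum_A (hA.sum_row_eq_one (one_le_sum_A hA) hr hv h e) hf hg

end Combinatorics

end FactorModel

namespace FactorModel

/-! ### Monotonicity and scaling of the BP map. -/

section BeliefPropagation

variable {V F : Type*} [Fintype V] [Fintype F] [DecidableEq V] [DecidableEq F] {q : ℕ}
variable {M : FactorModel V F q}

theorem varMsg_nonneg {m : M.Messages} (h : ∀ p, 0 ≤ m p) (i : V) (a : F) (k : Fin q) :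
    0 ≤ M.varMsg m i a k :=
  mul_nonneg (M.φ_nonneg i k) (Finset.prod_nonneg fun _ _ => h _)

theorem varMsg_mono {m m' : M.Messages} (h : ∀ p, 0 ≤ m p) (hle : m ≤ m') (i : V) (a : F)
    (k : Fin q) : M.varMsg m i a k ≤ M.varMsg m' i a k :=
  mul_le_mul_of_nonneg_left (Finset.prod_le_prod (fun _ _ => h _) fun _ _ => hle _)
    (M.φ_nonneg i k)

theorem bp_mono {m m' : M.Messages} (h : ∀ p, 0 ≤ m p) (hle : m ≤ m') : M.bp m ≤ M.bp m' :=
  fun _ => Finset.sum_le_sum fun _ _ => mul_le_mul_of_nonneg_left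
    (Finset.prod_le_prod (fun _ _ => varMsg_nonneg h _ _ _) fun _ _ => varMsg_mono h hle _ _ _)
    (M.ψ_pos _ _).le

theorem differentiable_bp : Differentiable ℝ M.bp := by
  unfold bp varMsg
  fun_prop

/-- Groups the links out of `e` by their variable, matching the nested products in `Θ`. -/
theorem A_mulVec_apply (u : M.Edge → ℝ) (e : M.Edge) :
    M.A.mulVec u e = ∑ j : {j // j ∈ M.scope e.fac} with j ≠ e.loc,
      ∑ f : M.Edge with f.var = (j : V) ∧ f.fac ≠ e.fac, u f := by
  classical
  rw [Finset.sum_comm' (t' := {f : M.Edge | M.Link e f})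
    (s' := fun f => {j : {j // j ∈ M.scope e.fac} | (j : V) = f.var ∧ j ≠ e.loc})]
  · rw [Matrix.mulVec, dotProduct, Finset.sum_filter]
    refine Finset.sum_congr rfl fun f _ => ?_
    split_ifs with h
    · have hsing : (Finset.univ.filter fun j : {j // j ∈ M.scope e.fac} =>
          (j : V) = f.var ∧ j ≠ e.loc) = {⟨f.var, h.1⟩} := by
        ext j
        simp only [Finset.mem_filter, Finset.mem_univ, true_and, Finset.mem_singleton]
        constructor
        · exact fun hj => Subtype.ext hj.1
        · rintro rfl
          exact ⟨rfl, fun hj => h.2.1 (congrArg Subtype.val hj)⟩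
      rw [hsing, Finset.sum_singleton, A_of_link h, one_mul]
    · rw [A_of_not_link h, zero_mul]
  · intro j f
    simp only [Finset.mem_filter, Finset.mem_univ, true_and]
    constructor
    · rintro ⟨hj, hf, hfac⟩
      exact ⟨⟨hf.symm, hj⟩, hf ▸ j.2, fun h => hj (Subtype.ext (hf.symm.trans h)), hfac⟩
    · rintro ⟨⟨hf, hj⟩, h⟩
      exact ⟨hj, hf.symm, h.2.2⟩

/-- Scaling the messages along each edge by a factor that does not depend on the state amounts to
an application of the matrix `A` to the logarithms of these factors. -/
theorem bp_exp_mul (u : M.Edge → ℝ) (m : M.Messages) :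
    M.bp (fun p => Real.exp (u p.1) * m p) = fun p => Real.exp (M.A.mulVec u p.1) * M.bp m p := by
  have hvar : ∀ (i : V) (a : F) (k : Fin q),
      M.varMsg (fun p => Real.exp (u p.1) * m p) i a k =
        Real.exp (∑ e : M.Edge with e.var = i ∧ e.fac ≠ a, u e) * M.varMsg m i a k := by
    intro i a k
    simp only [varMsg, Finset.prod_mul_distrib, Real.exp_sum]
    ring
  funext p
  simp only [bp, hvar, Finset.prod_mul_distrib, ← Real.exp_sum, A_mulVec_apply, Finset.mul_sum]
  exact Finset.sum_congr rfl fun x _ => by ring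

/-! ### Beliefs at a fixed point and eigenvectors of the two Jacobians. -/

section Beliefs

variable {m : M.Messages}

theorem varWeight_eq (e : M.Edge) (k : Fin q) :
    M.varWeight m e.var k = M.varMsg m e.var e.fac k * m (e, k) := by
  have : (Finset.univ.filter fun f : M.Edge => f.var = e.var) =
      insert e (Finset.univ.filter fun f : M.Edge => f.var = e.var ∧ f.fac ≠ e.fac) := by
    ext f
    simp only [Finset.mem_filter, Finset.mem_univ, true_and, Finset.mem_insert]
    constructor
    · intro hf
      by_cases hfac : f.fac = e.fac
      · exact Or.inl (Edge.ext_of_fac_var hfac hf)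
      · exact Or.inr ⟨hf, hfac⟩
    · rintro (rfl | hf)
      · rfl
      · exact hf.1
  rw [varWeight, this, Finset.prod_insert (by simp), varMsg]
  ring

theorem facWeight_eq (e : M.Edge) (x : {i // i ∈ M.scope e.fac} → Fin q) :
    M.facWeight m e.fac x = M.varMsg m e.var e.fac (x e.loc) * (M.ψ e.fac x *
      ∏ j : {j // j ∈ M.scope e.fac} with j ≠ e.loc, M.varMsg m j e.fac (x j)) := by
  rw [facWeight, ← Finset.mul_prod_erase _ _ (Finset.mem_univ e.loc), Finset.filter_ne']
  ring

/-- This is the fixed point equation multiplied by `n_{i → a}(k)`. It makes the beliefs marginally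
consistent. -/
theorem IsFixedPoint.sum_facWeight (hm : M.IsFixedPoint m) (e : M.Edge) (k : Fin q) :
    ∑ x : {i // i ∈ M.scope e.fac} → Fin q with x e.loc = k, M.facWeight m e.fac x =
      M.varWeight m e.var k := by
  rw [varWeight_eq, ← congrFun hm.fixed (e, k), bp, Finset.mul_sum]
  refine Finset.sum_congr rfl fun x hx => ?_
  rw [facWeight_eq, (Finset.mem_filter.1 hx).2]

theorem IsFixedPoint.facZ_eq (hm : M.IsFixedPoint m) (e : M.Edge) :
    M.facZ m e.fac = M.varZ m e.var := by
  rw [facZ, varZ, ← Finset.sum_fiberwise _ (fun x => x e.loc)]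
  exact Finset.sum_congr rfl fun k _ => hm.sum_facWeight e k

theorem IsFixedPoint.sum_facBelief (hm : M.IsFixedPoint m) (e : M.Edge) (k : Fin q) :
    ∑ x : {i // i ∈ M.scope e.fac} → Fin q with x e.loc = k, M.facBelief m e.fac x =
      M.varBelief m e.var k := by
  simp only [facBelief, varBelief, ← Finset.sum_div, hm.sum_facWeight, hm.facZ_eq]

theorem IsFixedPoint.sum_condBelief (hm : M.IsFixedPoint m) (e : M.Edge) {k : Fin q}
    (hk : M.varBelief m e.var k ≠ 0) (j : {i // i ∈ M.scope e.fac}) :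
    ∑ l, M.condBelief m e.fac e.loc j k l = 1 := by
  simp only [condBelief, ← Finset.sum_div]
  rw [div_eq_one_iff_eq hk, ← hm.sum_facBelief e k,
    ← Finset.sum_fiberwise (Finset.univ.filter fun x : {i // i ∈ M.scope e.fac} → Fin q =>
      x e.loc = k) (fun x => x j)]
  simp only [Finset.filter_filter]

theorem varBelief_ne_zero_of_J_ne_zero {p r : M.Edge × Fin q} (h : M.J m p r ≠ 0) :
    M.varBelief m p.1.var p.2 ≠ 0 := by
  intro h0
  refine h ?_
  simp only [J, Matrix.of_apply, condBelief]
  split_ifs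
  · exact Finset.sum_eq_zero fun x _ => by
      rw [show M.varBelief m (p.1.loc : V) p.2 = 0 from h0, div_zero]
  · rfl

theorem link_of_J_ne_zero {p r : M.Edge × Fin q} (h : M.J m p r ≠ 0) : M.Link p.1 r.1 := by
  by_contra hn
  exact h (by simp [J, hn])

theorem varBelief_ne_zero (hJ : (M.J m).IsIrreducible) (e : M.Edge) (k : Fin q) :
    M.varBelief m e.var k ≠ 0 := by
  obtain ⟨r, hr⟩ := hJ.exists_row_pos (e, k)
  exact varBelief_ne_zero_of_J_ne_zero hr.ne'

/-- A zero message would annihilate the belief `b_i(k)`, and with it a whole row of `J`. -/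
theorem IsFixedPoint.pos (hm : M.IsFixedPoint m) (hJ : (M.J m).IsIrreducible)
    (p : M.Edge × Fin q) : 0 < m p := by
  refine lt_of_le_of_ne (hm.nonneg p) fun h0 => varBelief_ne_zero hJ p.1 p.2 ?_
  rw [varBelief, varWeight_eq, Prod.mk.eta, ← h0, mul_zero, zero_div]

/-- Forgetting the states maps positive entries of `J` to links. -/
theorem A_isIrreducible [NeZero q] (hJ : (M.J m).IsIrreducible) : M.A.IsIrreducible :=
  hJ.of_surjective A_nonneg Prod.fst_surjective fun i j h => by
    rw [A_of_link (link_of_J_ne_zero h.ne')]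
    exact one_pos

/-- An eigenvector of `A`, extended by constants to the states, is an eigenvector of `J`. -/
theorem IsFixedPoint.J_mulVec (hm : M.IsFixedPoint m) (hJ : (M.J m).IsIrreducible)
    (v : M.Edge → ℝ) : (M.J m).mulVec (fun p => v p.1) = fun p => M.A.mulVec v p.1 := by
  funext ⟨e, k⟩
  have key : ∀ f, ∑ l, M.J m (e, k) (f, l) = M.A e f := by
    intro f
    by_cases h : M.Link e f
    · rw [A_of_link h, ← hm.sum_condBelief e (varBelief_ne_zero hJ e k) ⟨f.var, h.1⟩]
      exact Finset.sum_congr rfl fun l _ => dif_pos h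
    · rw [A_of_not_link h]
      exact Finset.sum_eq_zero fun l _ => dif_neg h
  simp only [Matrix.mulVec, dotProduct, Fintype.sum_prod_type, ← Finset.sum_mul, key]

theorem bpJacobian_nonneg (hm : ∀ p, 0 ≤ m p) (p r : M.Edge × Fin q) : 0 ≤ M.bpJacobian m p r := by
  set γ : ℝ → M.Messages := fun t => m + t • Pi.single r 1 with hγ
  have hγ' : HasDerivAt γ (Pi.single r 1) 0 := by
    have := ((hasDerivAt_id (0 : ℝ)).smul_const (Pi.single r (1 : ℝ) : M.Messages)).const_add m
    rwa [one_smul] at this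
  have h0 : γ 0 = m := by simp [hγ]
  have hd : HasDerivAt (fun t => M.bp (γ t) p) (M.bpJacobian m p r) 0 := by
    have h1 : HasFDerivAt M.bp (fderiv ℝ M.bp m) (γ 0) := by
      rw [h0]
      exact (differentiable_bp m).hasFDerivAt
    have h2 := hasDerivAt_pi.1 (h1.comp_hasDerivAt 0 hγ') p
    simpa [bpJacobian, LinearMap.toMatrix'_apply] using h2
  -- Only `t ≥ 0` is used: `bp` is monotone on nonnegative messages, and `m` may have zero
  -- coordinates here.
  have hmono : MonotoneOn (fun t => M.bp (γ t) p) (Set.Ici 0) := by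
    have hs : (0 : M.Messages) ≤ Pi.single r 1 := Pi.single_nonneg.2 zero_le_one
    intro s hs0 t _ hst
    refine bp_mono (fun p => ?_) ?_ p
    · exact add_nonneg (hm p) (mul_nonneg hs0 (hs p))
    · exact add_le_add_right (smul_le_smul_of_nonneg_right hst hs) m
  have := hmono.derivWithin_nonneg (x := 0)
  rwa [hd.hasDerivWithinAt.derivWithin (uniqueDiffWithinAt_Ici 0)] at this

/-- An eigenvector of `A`, multiplied by the messages of a fixed point, is an eigenvector of the
Jacobian matrix at this fixed point. -/
theorem bpJacobian_mulVec (hm : M.bp m = m) (v : M.Edge → ℝ) :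
    (M.bpJacobian m).mulVec (fun p => v p.1 * m p) = fun p => M.A.mulVec v p.1 * m p := by
  have hcurve : ∀ u : M.Edge → ℝ, HasDerivAt
      (fun t : ℝ => ((fun p => Real.exp ((t • u) p.1) * m p : M.Messages)))
      (fun p => u p.1 * m p) 0 := by
    intro u
    refine hasDerivAt_pi.2 fun p => ?_
    have := (((hasDerivAt_id (0 : ℝ)).mul_const (u p.1)).exp).mul_const (m p)
    simpa using this
  have h1 : HasFDerivAt M.bp (fderiv ℝ M.bp m)
      ((fun t : ℝ => ((fun p => Real.exp ((t • v) p.1) * m p : M.Messages))) 0) := by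
    have : ((fun t : ℝ => ((fun p => Real.exp ((t • v) p.1) * m p : M.Messages))) 0) = m := by
      funext p
      simp
    rw [this]
    exact (differentiable_bp m).hasFDerivAt
  have h2 := h1.comp_hasDerivAt 0 (hcurve v)
  have h3 := hcurve (M.A.mulVec v)
  -- BP maps the curve `exp (t v) m` to `exp (t A v) m`; the claim compares velocities at `t = 0`.
  have h4 : (M.bp ∘ fun t : ℝ => ((fun p => Real.exp ((t • v) p.1) * m p : M.Messages))) =
      fun t : ℝ => ((fun p => Real.exp ((t • M.A.mulVec v) p.1) * m p : M.Messages)) := by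
    funext t
    simp only [Function.comp_apply, bp_exp_mul, hm, Matrix.mulVec_smul]
  rw [h4] at h2
  rw [← h2.unique h3, bpJacobian, LinearMap.toMatrix'_mulVec]
  rfl

end Beliefs

/-! ### Explicit divergent orbits. -/

section Instability

variable {m : M.Messages} {r : ℝ} {v : M.Edge → ℝ}

theorem iterate_bp_exp_mul (hm : M.bp m = m) (h : M.A.mulVec v = r • v) (ε : ℝ) (n : ℕ) :
    M.bp^[n] (fun p => Real.exp (ε * v p.1) * m p) =
      fun p => Real.exp (ε * r ^ n * v p.1) * m p := by
  induction n with
  | zero => simp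
  | succ n ih =>
    rw [Function.iterate_succ_apply', ih]
    have := bp_exp_mul ((ε * r ^ n) • v) m
    simp only [Matrix.mulVec_smul, h, hm, Pi.smul_apply, smul_eq_mul] at this
    rw [this]
    funext p
    ring_nf

theorem tendsto_iterate_bp (hm : M.bp m = m) (h : M.A.mulVec v = r • v) (hr : 1 < r) {ε : ℝ}
    (hε : 0 < ε) {p : M.Edge × Fin q} (hv : 0 < v p.1) (hp : 0 < m p) :
    Tendsto (fun n : ℕ => M.bp^[n] (fun p => Real.exp (ε * v p.1) * m p) p) atTop atTop := by
  simp only [iterate_bp_exp_mul hm h]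
  refine (Real.tendsto_exp_atTop.comp ?_).atTop_mul_const hp
  exact ((tendsto_pow_atTop_atTop_of_one_lt hr).const_mul_atTop hε).atTop_mul_const hv

omit [Fintype V] [Fintype F] [DecidableEq V] [DecidableEq F] in
-- Divergent orbits start arbitrarily close to `m`: the curve `exp (ε v) m` stays positive and tends
-- to `m` as `ε → 0`.
theorem exists_exp_mul_of_eventually (hm : ∀ p, 0 < m p) (v : M.Edge → ℝ)
    {P : M.Messages → Prop} (h : ∀ᶠ y in 𝓝[M.posMessages] m, P y) :
    ∃ ε : ℝ, 0 < ε ∧ P (fun p => Real.exp (ε * v p.1) * m p) := by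
  have ht : Tendsto (fun ε : ℝ => (fun p => Real.exp (ε * v p.1) * m p : M.Messages)) (𝓝[>] 0)
      (𝓝[M.posMessages] m) := by
    refine tendsto_nhdsWithin_iff.2 ⟨?_, Eventually.of_forall fun ε p =>
      mul_pos (Real.exp_pos _) (hm p)⟩
    have hc : Continuous (fun ε : ℝ => (fun p => Real.exp (ε * v p.1) * m p : M.Messages)) := by
      fun_prop
    refine (hc.tendsto' 0 m ?_).mono_left nhdsWithin_le_nhds
    funext p
    simp
  obtain ⟨ε, hP, hε⟩ := ((ht.eventually h).and self_mem_nhdsWithin).exists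
  exact ⟨ε, hε, hP⟩

variable [Nonempty (M.Edge × Fin q)]

theorem not_isLyapunovStable (hfix : M.bp m = m) (hm : ∀ p, 0 < m p) (hv : ∀ e, 0 < v e)
    (h : M.A.mulVec v = r • v) (hr : 1 < r) : ¬ IsLyapunovStable M.bp M.posMessages m := by
  intro hs
  obtain ⟨p⟩ := ‹Nonempty (M.Edge × Fin q)›
  have hU : {y : M.Messages | y p < m p + 1} ∈ 𝓝 m :=
    (continuous_apply p).continuousAt.eventually_lt continuousAt_const (lt_add_one (m p))
  obtain ⟨ε, hε, hP⟩ := exists_exp_mul_of_eventually hm v (hs _ hU)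
  obtain ⟨n, hn⟩ :=
    ((tendsto_iterate_bp hfix h hr hε (hv p.1) (hm p)).eventually_ge_atTop (m p + 1)).exists
  exact (hP n).not_ge hn

theorem not_isLocallyAttractive (hfix : M.bp m = m) (hm : ∀ p, 0 < m p) (hv : ∀ e, 0 < v e)
    (h : M.A.mulVec v = r • v) (hr : 1 < r) : ¬ IsLocallyAttractive M.bp M.posMessages m := by
  intro hs
  obtain ⟨p⟩ := ‹Nonempty (M.Edge × Fin q)›
  obtain ⟨ε, hε, hP⟩ := exists_exp_mul_of_eventually hm v hs
  exact not_tendsto_nhds_of_tendsto_atTop (tendsto_iterate_bp hfix h hr hε (hv p.1) (hm p)) _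
    (tendsto_pi_nhds.1 hP p)

end Instability

end BeliefPropagation

end FactorModel

/-- If the factor graph is connected and has more than one independent cycle, then no fixed point
of plain belief propagation whose belief Jacobian is irreducible is stable: it is neither Lyapunov
stable nor locally attractive, even for perturbations within the positive messages, and the
Jacobian of the update and the matrix `J` both have as spectral radius the Perron eigenvalue of
`A`, which is greater than `1`. -/
theorem mainTheorem3 {V F : Type*} [Fintype V] [Fintype F] [DecidableEq V] [DecidableEq F] {q : ℕ}
    (M : FactorModel V F q) (hconn : M.graph.Connected) (hC : 1 < M.numCycles)
    (m : M.Messages) (hm : M.IsFixedPoint m) (hJ : (M.J m).IsIrreducible) :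
    (∃ r : ℝ, IsPerronEigenvalue M.A r ∧ 1 < r ∧
      matrixSpectralRadius (M.J m) = ENNReal.ofReal r ∧
      matrixSpectralRadius (M.bpJacobian m) = ENNReal.ofReal r) ∧
    ¬ IsLyapunovStable M.bp M.posMessages m ∧
    ¬ IsLocallyAttractive M.bp M.posMessages m := by
  have := FactorModel.nonempty_edge_of_numCycles hC
  -- For `q = 0` every `Z_i` would be an empty sum.
  have hq : NeZero q := by
    refine ⟨?_⟩
    rintro rfl
    obtain ⟨e⟩ := ‹Nonempty M.Edge›
    exact hm.varZ_ne_zero e.var (by simp [FactorModel.varZ])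
  have hA := FactorModel.A_isIrreducible hJ
  have hpos := hm.pos hJ
  obtain ⟨r, hr, v, hv, hAv⟩ := hA.exists_pos_eigenvector
  have hr1 := FactorModel.one_lt_of_pos_eigenvector hC hA hv hAv
  refine ⟨⟨r, ⟨hr, Matrix.spectralRadius_eq_of_pos_eigenvector hA.nonneg hv hAv, v, hv, hAv⟩,
    hr1, ?_, ?_⟩, FactorModel.not_isLyapunovStable hm.fixed hpos hv hAv hr1,
    FactorModel.not_isLocallyAttractive hm.fixed hpos hv hAv hr1⟩
  · refine Matrix.spectralRadius_eq_of_pos_eigenvector hJ.nonneg (v := fun p => v p.1)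
      (fun p => hv p.1) ?_
    rw [hm.J_mulVec hJ, hAv]
    rfl
  · refine Matrix.spectralRadius_eq_of_pos_eigenvector (FactorModel.bpJacobian_nonneg hm.nonneg)
      (v := fun p => v p.1 * m p) (fun p => mul_pos (hv p.1) (hpos p)) ?_
    rw [FactorModel.bpJacobian_mulVec hm.fixed, hAv]
    funext p
    simp [mul_assoc]
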